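/- Let $n\ge 0$, $0\le \ell_1\le \ell$, $I_1=\{1,\dots,\ell_1\}$, $I_2=\{\ell_1+1,\dots,\ell\}$, $I=I_1\cup I_2$, and let $a_i\in\mathbb R^n$, $b_i\in\mathbb R$ for $i\in I$. Put $$\Theta=\{x\in\mathbb R^n:\langle a_i,x\rangle\le b_i\ \forall i\in I_1\},\qquad \mathcal C=\{x\in\mathbb R^n:\langle a_i,x\rangle\le b_i\ \forall i\in I_2\}.$$ Let $\mathcal N(x)=N(x,\Theta)$ be the (limiting) normal cone to $\Theta$ at $x$ if $x\in\Theta$, and $\mathcal N(x)=\emptyset$ otherwise. For $x\in\mathbb R^n$ let $I_1(x)=\{i\in I_1:\langle a_i,x\rangle=b_i\}$ and $I(x)=\{i\in I:\langle a_i,x\rangle=b_i\}$. For $P\subset Q\subset I$ with $P\subset I_1$ put $Q|_{I_j}=Q\cap I_j$ and $$\mathcal T_Q=\{u:\langle a_i,u\rangle\le 0\ \forall i\in Q\},\qquad B_{Q,P}=\{u\in\mathcal T_Q:\langle a_i,u\rangle=0\ \forall i\in P\},$$ $$A_{Q,P}=\operatorname{cone}\{a_i:i\in Q\setminus P\}+\operatorname{span}\{a_i:i\in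 P\},$$ $$C_Q=\{x\in\mathbb R^n:\langle a_i,x\rangle=b_i\ \forall i\in Q,\ \langle a_i,x\rangle<b_i\ \forall i\in I\setminus Q\},$$ where $\operatorname{cone}$ denotes the generated convex cone ($\operatorname{cone}\emptyset=\{0\}$). Let $\bar x\in\mathcal C\cap\Theta$ and $\bar x^*\in\mathcal N(\bar x)$; put $\bar I=I(\bar x)$, $\mathcal P(\bar x,\bar x^*)=\{P\subset I_1(\bar x):\bar x^*\in\operatorname{cone}\{a_i:i\in P\}\}$ and $G(x)=-\bar x^*+\mathcal N(x)$ for $x\in\mathbb R^n$. A multifunction $F:\mathbb R^n\rightrightarrows\mathbb R^n$ has the Aubin property with respect to $\mathcal C$ at $(\bar x,\bar y)\in\operatorname{gph}F$ if $\operatorname{gph}F$ is locally closed around $(\bar x,\bar y)$ and there are $\kappa\ge0$ and neighborhoods $V$ of $\bar y$ and $U$ of $\bar x$ such that $F(u)\cap V\subset F(x)+\kappa\|u-x\|\mathbb B$ for all $x,u\in\mathcal C\cap U$, where $\mathbb B$ is the closed unit ball. (i) $G$ has the Aubin property with respect to $\mathcal C$ at $(\bar x,0)$ if and only if, for all $Q\subset\bar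 I$ and $P\in\mathcal P(\bar x,\bar x^*)$ with $C_Q\neq\emptyset$ and $P\subset Q|_{I_1}$, and all $v\in\mathbb R^n$, $$(v,0)\in (A_{Q,P}\cap\mathcal T_{Q|_{I_2}})\times B_{Q|_{I_1},P}\ \Longrightarrow\ v=0.$$ (ii) Suppose in addition that the family $(a_i)_{i\in I(\bar x)}$ is linearly independent. Write $\bar x^*=\sum_{i\in I_1(\bar x)}\lambda_ia_i$ with all $\lambda_i\ge0$, and put $\mathcal I(\bar x,\bar x^*)=\{i\in I_1(\bar x):\lambda_i>0\}$. Then $G$ has the Aubin property with respect to $\mathcal C$ at $(\bar x,0)$ if and only if, for all $Q\subset\bar I$, all $P$ with $\mathcal I(\bar x,\bar x^*)\subset P\subset Q|_{I_1}$, and all $v\in\mathbb R^n$, $$(v,0)\in (A_{Q,P}\cap\mathcal T_{Q|_{I_2}})\times B_{Q|_{I_1},P}\ \Longrightarrow\ v=0.$$ -/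

import Mathlib

open scoped Pointwise Topology
open Filter

namespace RelAubin

/-- The space `ℝⁿ` with the Euclidean norm and scalar product. -/
abbrev E (n : ℕ) : Type := EuclideanSpace ℝ (Fin n)

section General

variable {n : ℕ}

/-- The Euclidean projector set `Π(x, Ω)`. -/
def projSet (x : E n) (Ω : Set (E n)) : Set (E n) :=
  {u | u ∈ Ω ∧ ‖u - x‖ = Metric.infDist x Ω}

/-- The set `cone [x - Π(x, Ω)]`, where `cone S = {t s : t ≥ 0, s ∈ S}`. -/
def proxDirections (Ω : Set (E n)) (x : E n) : Set (E n) :=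
  {y | ∃ t : ℝ, 0 ≤ t ∧ ∃ p ∈ projSet x Ω, y = t • (x - p)}

/-- The sequential Painlevé–Kuratowski outer limit of a multifunction at `x`. -/
def outerLimit (F : E n → Set (E n)) (x : E n) : Set (E n) :=
  {y | ∃ (xs ys : ℕ → E n), Tendsto xs atTop (𝓝 x) ∧ Tendsto ys atTop (𝓝 y) ∧
    ∀ k, ys k ∈ F (xs k)}

/-- The limiting normal cone `N(x, Ω)` at a point `x ∈ Ω`. -/
def limitingNormalCone (x : E n) (Ω : Set (E n)) : Set (E n) :=
  outerLimit (proxDirections Ω) x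

/-- The normal cone mapping to `Ω`: `N(x, Ω)` if `x ∈ Ω`, and empty otherwise. -/
def normalConeMap (Ω : Set (E n)) (x : E n) : Set (E n) :=
  {y | x ∈ Ω ∧ y ∈ limitingNormalCone x Ω}

/-- The graph of a multifunction. -/
def gph (F : E n → Set (E n)) : Set (E n × E n) :=
  {z | z.2 ∈ F z.1}

/-- `S` is locally closed around `z`. -/
def LocallyClosedAround (S : Set (E n × E n)) (z : E n × E n) : Prop :=
  ∃ W ∈ 𝓝 z, IsClosed W ∧ IsClosed (S ∩ W)

/-- The Aubin property of `F` with respect to `C` around `(x, y) ∈ gph F`. -/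
def HasAubinProperty (F : E n → Set (E n)) (C : Set (E n)) (x y : E n) : Prop :=
  (x, y) ∈ gph F ∧ LocallyClosedAround (gph F) (x, y) ∧
    ∃ κ : ℝ, 0 ≤ κ ∧ ∃ V ∈ 𝓝 y, ∃ U ∈ 𝓝 x, ∀ x' ∈ C ∩ U, ∀ u ∈ C ∩ U,
      F u ∩ V ⊆ F x' + (κ * ‖u - x'‖) • Metric.closedBall (0 : E n) 1

end General

section Polyhedra

variable {n l : ℕ}

/-- The index set `I₁`, the first `l₁` indices of `I = Fin l`. -/
def I₁ (l l₁ : ℕ) : Set (Fin l) := {i | i.val < l₁}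

/-- The index set `I₂`, the remaining indices of `I = Fin l`. -/
def I₂ (l l₁ : ℕ) : Set (Fin l) := {i | l₁ ≤ i.val}

/-- The polyhedron `{x : ⟨aᵢ, x⟩ ≤ bᵢ for all i ∈ J}`. -/
def polyhedron (a : Fin l → E n) (b : Fin l → ℝ) (J : Set (Fin l)) : Set (E n) :=
  {x | ∀ i ∈ J, inner ℝ (a i) x ≤ b i}

/-- The active index set `{i ∈ J : ⟨aᵢ, x⟩ = bᵢ}`; `J` is `I₁`, `I₂` or all of `I`. -/
def activeIn (a : Fin l → E n) (b : Fin l → ℝ) (J : Set (Fin l)) (x : E n) : Set (Fin l) :=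
  {i | i ∈ J ∧ inner ℝ (a i) x = b i}

/-- The face `C_Q`: points of `ℝⁿ` at which exactly the constraints of index in `Q` are active
and all the others are strictly satisfied. -/
def faceSet (a : Fin l → E n) (b : Fin l → ℝ) (Q : Set (Fin l)) : Set (E n) :=
  {x | (∀ i ∈ Q, inner ℝ (a i) x = b i) ∧ ∀ i ∉ Q, inner ℝ (a i) x < b i}

/-- `cone {aᵢ : i ∈ S}`, the convex cone generated by the `aᵢ` (it is `{0}` for empty `S`). -/
def coneOf (a : Fin l → E n) (S : Set (Fin l)) : Set (E n) :=
  (PointedCone.hull ℝ (a '' S) : Set (E n))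

/-- `𝒯_Q`. -/
def setT (a : Fin l → E n) (Q : Set (Fin l)) : Set (E n) :=
  {u | ∀ i ∈ Q, inner ℝ (a i) u ≤ 0}

/-- `B_{Q,P}`. -/
def setB (a : Fin l → E n) (Q P : Set (Fin l)) : Set (E n) :=
  {u | u ∈ setT a Q ∧ ∀ i ∈ P, inner ℝ (a i) u = 0}

/-- `A_{Q,P} = cone {aᵢ : i ∈ Q \ P} + span {aᵢ : i ∈ P}`. -/
def setA (a : Fin l → E n) (Q P : Set (Fin l)) : Set (E n) :=
  coneOf a (Q \ P) + (Submodule.span ℝ (a '' P) : Set (E n))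

/-- `𝒫(x, y)`: the sets `P ⊆ I₁(x)` with `y ∈ cone {aᵢ : i ∈ P}`. -/
def familyP (l₁ : ℕ) (a : Fin l → E n) (b : Fin l → ℝ) (x y : E n) : Set (Set (Fin l)) :=
  {P | P ⊆ activeIn a b (I₁ l l₁) x ∧ y ∈ coneOf a P}

/-- `lam` are multipliers of `y` at `x`: `y = ∑ lamᵢ aᵢ` with `lam ≥ 0` vanishing
outside `I₁(x)`. -/
def IsMultiplier (l₁ : ℕ) (a : Fin l → E n) (b : Fin l → ℝ) (x y : E n)
    (lam : Fin l → ℝ) : Prop :=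
  (∀ i, 0 ≤ lam i) ∧ (∀ i ∉ activeIn a b (I₁ l l₁) x, lam i = 0) ∧ y = ∑ i, lam i • a i

/-- The set `𝓘(x, y) = {i : lamᵢ > 0}` belonging to the multipliers `lam` of `y` at `x`. -/
def positiveSupport (lam : Fin l → ℝ) : Set (Fin l) := {i | 0 < lam i}

/-- The mapping `G(x) = -y + N(x, Θ)`, with empty values outside `Θ`. -/
def mapG (Θ : Set (E n)) (y : E n) (x : E n) : Set (E n) :=
  {z | ∃ w ∈ normalConeMap Θ x, z = -y + w}

end Polyhedra

end RelAubin

namespace RelAubin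

/-! Both the Aubin property and the face condition are equivalent to one linear statement: every
direction `d` tangent to `C` at `xbar` satisfies `⟨aᵢ, d⟩ = 0` for all `i ∈ I₁(xbar)`. In particular
the choice of `xstar` does not matter.

Aubin property: near `xbar`, `G` must have nonempty values on `C`, so `C` lies locally in `Θ`, and
small perturbations `xstar + ε aᵢ` must be approximated by normals at `xbar + s d`; letting `s → 0`
gives the equality (`inner_eq_zero_of_hasAubinProperty`). Conversely, under the equality all points
of `C` near `xbar` have the same active `Θ`-constraints, so the normal cone is constant there and `κ
= 0` works (`hasAubinProperty_of_inner_eq_zero`).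

Face condition: under the equality, a vector `v` admitted by it lies in `A_{Q,P}` and in the polar
of `A_{Q,P}`, hence vanishes (`eq_zero_of_mem_setA_inter_setT`). Conversely, a single pair suffices:
`P = I₁(xbar)` and a minimal `Q`, for which `A_{Q,P}` contains the whole span of `{aᵢ : i ∈ Q}`
(`inner_eq_zero_of_face_condition`).

For (ii), linear independence makes every face nonempty and the multipliers unique. -/

/-- **Farkas' lemma**: a vector whose inner product with `u` is nonpositive whenever all the
`aᵢ`, `i ∈ s`, have this property is a nonnegative combination of the `aᵢ`. -/
theorem exists_nonneg_combination_of_inner_nonpos {ι F : Type*} [NormedAddCommGroup F]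
    [InnerProductSpace ℝ F] (s : Finset ι) (a : ι → F) (g : F)
    (h : ∀ u, (∀ i ∈ s, inner ℝ (a i) u ≤ 0) → inner ℝ g u ≤ 0) :
    ∃ c : ι → ℝ, (∀ i, 0 ≤ c i) ∧ g = ∑ i ∈ s, c i • a i := by
  classical
  induction s using Finset.induction_on generalizing a g with
  | empty =>
    refine ⟨0, fun _ => le_rfl, ?_⟩
    have := h g (by simp)
    simpa using this
  | insert j s hj ih =>
    by_cases hs : ∀ u, (∀ i ∈ s, inner ℝ (a i) u ≤ 0) → inner ℝ g u ≤ 0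
    · obtain ⟨c, hc, hg⟩ := ih a g hs
      refine ⟨Function.update c j 0, fun i => ?_, ?_⟩
      · by_cases hij : i = j
        · subst hij; simp
        · simpa [hij] using hc i
      · rw [Finset.sum_insert hj, hg]
        simp only [Function.update_self, zero_smul, zero_add]
        refine Finset.sum_congr rfl fun i hi => ?_
        rw [Function.update_of_ne (ne_of_mem_of_not_mem hi hj)]
    · push Not at hs
      obtain ⟨u, hu, hgu⟩ := hs
      have hju : 0 < inner ℝ (a j) u := by
        by_contra hcon
        push Not at hcon
        refine absurd (h u fun i hi => ?_) (not_le.2 hgu)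
        rcases Finset.mem_insert.1 hi with rfl | hi
        · exact hcon
        · exact hu i hi
      set r := inner ℝ (a j) u with hr
      -- The oblique projection `w ↦ w - (⟨a j, w⟩ / r) • u` maps onto the hyperplane orthogonal to
      -- `a j`; its adjoint, applied to the `a i` and to `g`, eliminates the generator `a j`.
      obtain ⟨c, hc, hg⟩ := ih (fun i => a i - (inner ℝ (a i) u / r) • a j)
        (g - (inner ℝ g u / r) • a j) (by
          intro w hw
          have := h (w - (inner ℝ (a j) w / r) • u) (by
            intro i hi
            rcases Finset.mem_insert.1 hi with rfl | hi
            · rw [inner_sub_right, inner_smul_right, ← hr, div_mul_cancel₀ _ hju.ne', sub_self]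
            · have := hw i hi
              rw [inner_sub_left, real_inner_smul_left] at this
              rw [inner_sub_right, inner_smul_right]
              convert this using 1
              ring)
          rw [inner_sub_right, inner_smul_right] at this
          rw [inner_sub_left, real_inner_smul_left]
          convert this using 1
          ring)
      -- The coefficient of `a j` when the projection is undone; its sign follows from `⟨g, u⟩ > 0`
      -- and `⟨a i, u⟩ ≤ 0` on `s`.
      have hk : 0 ≤ inner ℝ g u / r - ∑ i ∈ s, c i * (inner ℝ (a i) u / r) := by
        have h1 : 0 ≤ inner ℝ g u / r := by positivity
        have h2 : ∑ i ∈ s, c i * (inner ℝ (a i) u / r) ≤ 0 :=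
          Finset.sum_nonpos fun i hi => mul_nonpos_of_nonneg_of_nonpos (hc i)
            (div_nonpos_of_nonpos_of_nonneg (hu i hi) hju.le)
        linarith
      refine ⟨Function.update c j
        (inner ℝ g u / r - ∑ i ∈ s, c i * (inner ℝ (a i) u / r)), fun i => ?_, ?_⟩
      · by_cases hij : i = j
        · subst hij; simpa using hk
        · simpa [hij] using hc i
      · rw [Finset.sum_insert hj, Function.update_self]
        have hsum : ∑ i ∈ s, Function.update c j
            (inner ℝ g u / r - ∑ i ∈ s, c i * (inner ℝ (a i) u / r)) i • a i
            = ∑ i ∈ s, c i • a i :=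
          Finset.sum_congr rfl fun i hi => by
            rw [Function.update_of_ne (ne_of_mem_of_not_mem hi hj)]
        rw [hsum]
        simp only [smul_sub, Finset.sum_sub_distrib, smul_smul, ← Finset.sum_smul] at hg
        rw [sub_smul, add_comm, ← add_sub_assoc, add_sub_right_comm, ← hg, sub_add_cancel]

/-! ### Normal cones to convex sets -/

section NormalCone

variable {n : ℕ}

/-- The projections onto a convex set are characterized by the variational inequality. -/
theorem mem_projSet_iff {Ω : Set (E n)} (hconv : Convex ℝ Ω) {x p : E n} :
    p ∈ projSet x Ω ↔ p ∈ Ω ∧ ∀ z ∈ Ω, inner ℝ (x - p) (z - p) ≤ 0 := by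
  refine and_congr_right fun hp => ?_
  rw [← norm_eq_iInf_iff_real_inner_le_zero hconv hp, Metric.infDist_eq_iInf, norm_sub_rev]
  simp only [dist_eq_norm]

/-- For a convex set, the limiting normal cone is the normal cone of convex analysis. -/
theorem mem_normalConeMap_iff {Ω : Set (E n)} (hconv : Convex ℝ Ω) {x y : E n} :
    y ∈ normalConeMap Ω x ↔ x ∈ Ω ∧ ∀ z ∈ Ω, inner ℝ y (z - x) ≤ 0 := by
  refine and_congr_right fun hx => ⟨?_, fun hy => ?_⟩
  · rintro ⟨xs, ys, hxs, hys, hmem⟩ z hz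
    choose t ht p hp hyp using hmem
    have hple : ∀ k, ‖p k - x‖ ≤ 2 * ‖xs k - x‖ := fun k => by
      have h1 : ‖p k - xs k‖ ≤ ‖xs k - x‖ := by
        rw [(hp k).2, ← dist_eq_norm]
        exact Metric.infDist_le_dist_of_mem hx
      calc ‖p k - x‖ = ‖(p k - xs k) + (xs k - x)‖ := by rw [sub_add_sub_cancel]
        _ ≤ ‖p k - xs k‖ + ‖xs k - x‖ := norm_add_le _ _
        _ ≤ 2 * ‖xs k - x‖ := by linarith
    have hpx : Tendsto p atTop (𝓝 x) := by
      rw [tendsto_iff_norm_sub_tendsto_zero] at hxs ⊢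
      refine squeeze_zero (fun _ => norm_nonneg _) hple ?_
      simpa using hxs.const_mul 2
    have hlim : Tendsto (fun k => inner ℝ (ys k) (z - p k)) atTop (𝓝 (inner ℝ y (z - x))) :=
      hys.inner (tendsto_const_nhds.sub hpx)
    refine le_of_tendsto hlim (Eventually.of_forall fun k => ?_)
    rw [hyp k, real_inner_smul_left]
    exact mul_nonpos_of_nonneg_of_nonpos (ht k) (((mem_projSet_iff hconv).1 (hp k)).2 z hz)
  -- Every point `x + t y` with `t > 0` projects to `x`, so `y` itself is a proximal direction at
  -- points tending to `x`.
  · refine ⟨fun k => x + (1 / ((k : ℝ) + 1)) • y, fun _ => y, ?_, tendsto_const_nhds,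
      fun k => ⟨(k : ℝ) + 1, by positivity, x, (mem_projSet_iff hconv).2 ⟨hx, fun z hz => ?_⟩, ?_⟩⟩
    · simpa using tendsto_const_nhds.add
        ((tendsto_one_div_add_atTop_nhds_zero_nat (𝕜 := ℝ)).smul_const y)
    · rw [add_sub_cancel_left, real_inner_smul_left]
      exact mul_nonpos_of_nonneg_of_nonpos (by positivity) (hy z hz)
    · rw [add_sub_cancel_left, smul_smul, mul_one_div_cancel (by positivity), one_smul]

/-- The graph of `x ↦ -y + N(x, Ω)` is closed for a closed convex set `Ω`. -/
theorem isClosed_gph_mapG {Ω : Set (E n)} (hconv : Convex ℝ Ω) (hcl : IsClosed Ω) (y : E n) :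
    IsClosed (gph (mapG Ω y)) := by
  have : gph (mapG Ω y) = (Prod.fst ⁻¹' Ω) ∩
      ⋂ z ∈ Ω, {q : E n × E n | inner ℝ (y + q.2) (z - q.1) ≤ 0} := by
    ext ⟨x, g⟩
    simp only [gph, mapG, Set.mem_ofPred_eq, Set.mem_inter_iff, Set.mem_preimage, Set.mem_iInter]
    rw [← mem_normalConeMap_iff hconv]
    constructor
    · rintro ⟨w, hw, rfl⟩
      simpa using hw
    · exact fun h => ⟨_, h, by abel⟩
  rw [this]
  refine (hcl.preimage continuous_fst).inter (isClosed_biInter fun z _ => ?_)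
  exact isClosed_le (by fun_prop) continuous_const

end NormalCone

/-! ### Polyhedra, feasible directions and polar cones -/

section Polyhedra

variable {n l : ℕ} (a : Fin l → E n) (b : Fin l → ℝ)

theorem mem_coneOf_iff {S : Set (Fin l)} {v : E n} :
    v ∈ coneOf a S ↔ ∃ c : Fin l → ℝ, (∀ i, 0 ≤ c i) ∧ (∀ i ∉ S, c i = 0) ∧
      v = ∑ i, c i • a i := by
  classical
  constructor
  · intro hv
    refine Submodule.span_induction (p := fun v _ => ∃ c : Fin l → ℝ, (∀ i, 0 ≤ c i) ∧
      (∀ i ∉ S, c i = 0) ∧ v = ∑ i, c i • a i) ?_ ?_ ?_ ?_ hv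
    · rintro _ ⟨i, hi, rfl⟩
      refine ⟨Pi.single i 1, fun j => ?_, fun j hj => ?_, ?_⟩
      · by_cases hij : j = i
        · subst hij; simp
        · simp [hij]
      · exact Pi.single_eq_of_ne (ne_of_mem_of_not_mem hi hj).symm _
      · simp [Pi.single_apply, ite_smul]
    · exact ⟨0, fun _ => le_rfl, fun _ _ => rfl, by simp⟩
    · rintro _ _ _ _ ⟨c, hc, hcS, rfl⟩ ⟨c', hc', hcS', rfl⟩
      refine ⟨c + c', fun i => add_nonneg (hc i) (hc' i), fun i hi => ?_, ?_⟩
      · simp [hcS i hi, hcS' i hi]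
      · simp [add_smul, Finset.sum_add_distrib]
    · rintro r _ _ ⟨c, hc, hcS, rfl⟩
      refine ⟨fun i => (r : ℝ) * c i, fun i => mul_nonneg r.2 (hc i), fun i hi => ?_, ?_⟩
      · simp [hcS i hi]
      · rw [Finset.smul_sum]
        refine Finset.sum_congr rfl fun i _ => ?_
        rw [mul_smul]; rfl
  · rintro ⟨c, hc, hcS, rfl⟩
    refine Submodule.sum_mem _ fun i _ => ?_
    by_cases hi : i ∈ S
    · exact Submodule.smul_mem _ (⟨c i, hc i⟩ : {c : ℝ // 0 ≤ c})
        (Submodule.subset_span ⟨i, hi, rfl⟩)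
    · rw [hcS i hi, zero_smul]
      exact Submodule.zero_mem _

theorem convex_polyhedron (J : Set (Fin l)) : Convex ℝ (polyhedron a b J) := by
  have : polyhedron a b J = ⋂ i ∈ J, {x | inner ℝ (a i) x ≤ b i} := by
    ext; simp [polyhedron]
  rw [this]
  exact convex_iInter₂ fun i _ => convex_halfSpace_le (innerₗ (E n) (a i)).isLinear _

theorem isClosed_polyhedron (J : Set (Fin l)) : IsClosed (polyhedron a b J) := by
  have : polyhedron a b J = ⋂ i ∈ J, {x | inner ℝ (a i) x ≤ b i} := by
    ext; simp [polyhedron]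
  rw [this]
  exact isClosed_biInter fun i _ => isClosed_le (by fun_prop) continuous_const

/-- Inactive constraints remain strictly satisfied near a point. -/
theorem eventually_inner_lt (J : Set (Fin l)) (x : E n)
    (h : ∀ i ∈ J, inner ℝ (a i) x < b i) :
    ∀ᶠ u in 𝓝 x, ∀ i ∈ J, inner ℝ (a i) u < b i := by
  rw [eventually_all_finite J.toFinite]
  intro i hi
  have : Continuous fun u : E n => inner ℝ (a i) u := by fun_prop
  exact this.continuousAt.eventually_lt continuousAt_const (h i hi)

theorem tendsto_add_smul (x d : E n) :
    Tendsto (fun s : ℝ => x + s • d) (𝓝[>] 0) (𝓝 x) := by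
  have : Continuous fun s : ℝ => x + s • d := by fun_prop
  simpa using (this.tendsto 0).mono_left nhdsWithin_le_nhds

/-- Directions along which the active constraints do not increase are feasible. -/
theorem eventually_add_smul_mem_polyhedron {J : Set (Fin l)} {x d : E n}
    (hx : x ∈ polyhedron a b J) (hd : d ∈ setT a (activeIn a b J x)) :
    ∀ᶠ s : ℝ in 𝓝[>] 0, x + s • d ∈ polyhedron a b J := by
  have h := (tendsto_add_smul x d).eventually
    (eventually_inner_lt a b {i | i ∈ J ∧ inner ℝ (a i) x < b i} x fun i hi => hi.2)
  filter_upwards [h, self_mem_nhdsWithin] with s hs hs0 i hi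
  rcases (hx i hi).lt_or_eq with hlt | heq
  · exact (hs i ⟨hi, hlt⟩).le
  · rw [inner_add_right, inner_smul_right, heq]
    have := mul_nonpos_of_nonneg_of_nonpos (le_of_lt hs0) (hd i ⟨hi, heq⟩)
    linarith

/-- A direction along which exactly the constraints in `Q` stay active among the active ones
leads into the face `C_Q`. -/
theorem faceSet_nonempty {Q : Set (Fin l)} {x d : E n}
    (hx : x ∈ polyhedron a b Set.univ) (hQ : Q ⊆ activeIn a b Set.univ x)
    (hdQ : ∀ i ∈ Q, inner ℝ (a i) d = 0)
    (hd : ∀ i ∈ activeIn a b Set.univ x, i ∉ Q → inner ℝ (a i) d < 0) :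
    (faceSet a b Q).Nonempty := by
  have h := (tendsto_add_smul x d).eventually
    (eventually_inner_lt a b {i | inner ℝ (a i) x < b i} x fun i hi => hi)
  obtain ⟨s, hs, hs0⟩ := (h.and self_mem_nhdsWithin).exists
  refine ⟨x + s • d, fun i hi => ?_, fun i hi => ?_⟩
  · rw [inner_add_right, inner_smul_right, hdQ i hi, (hQ hi).2, mul_zero, add_zero]
  · rcases (hx i trivial).lt_or_eq with hlt | heq
    · exact hs i hlt
    · rw [inner_add_right, inner_smul_right, heq]
      have := mul_neg_of_pos_of_neg hs0 (hd i ⟨trivial, heq⟩ hi)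
      linarith

/-- Normal vectors of a polyhedron are generated by the gradients of the active constraints. -/
theorem mem_coneOf_activeIn_of_normal {J : Set (Fin l)} {x y : E n}
    (hx : x ∈ polyhedron a b J) (hy : ∀ z ∈ polyhedron a b J, inner ℝ y (z - x) ≤ 0) :
    y ∈ coneOf a (activeIn a b J x) := by
  classical
  obtain ⟨c, hc, hyc⟩ := exists_nonneg_combination_of_inner_nonpos
    (activeIn a b J x).toFinite.toFinset a y (by
      intro u hu
      obtain ⟨s, hs, hs0⟩ := ((eventually_add_smul_mem_polyhedron a b hx
        (fun i hi => hu i (by simpa using hi)) :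
        ∀ᶠ s : ℝ in 𝓝[>] 0, x + s • u ∈ polyhedron a b J).and self_mem_nhdsWithin).exists
      have := hy _ hs
      rw [add_sub_cancel_left, inner_smul_right] at this
      exact nonpos_of_mul_nonpos_right this hs0)
  refine (mem_coneOf_iff a).2 ⟨fun i => if i ∈ activeIn a b J x then c i else 0,
    fun i => ?_, fun i hi => if_neg hi, ?_⟩
  · dsimp only
    split_ifs
    exacts [hc i, le_rfl]
  · rw [hyc]
    simp only [ite_smul, zero_smul]
    rw [← Finset.sum_filter]
    refine Finset.sum_congr ?_ fun _ _ => rfl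
    ext; simp

/-- Bipolar theorem for `A_{Q,P}`. -/
theorem mem_setA_of_inner_nonpos {Q P : Set (Fin l)} (hPQ : P ⊆ Q) {m : E n}
    (h : ∀ u ∈ setB a Q P, inner ℝ m u ≤ 0) : m ∈ setA a Q P := by
  classical
  -- Equalities on `P` are pairs of inequalities: the extra generators `-a i`, `i ∈ P`, turn the
  -- cone over `P` into a span.
  obtain ⟨c, hc, hm⟩ := exists_nonneg_combination_of_inner_nonpos
    (Finset.disjSum (Q.toFinite.toFinset) (P.toFinite.toFinset))
    (Sum.elim a fun i => -a i) m (by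
      intro u hu
      have h1 : ∀ i ∈ Q, inner ℝ (a i) u ≤ 0 := fun i hi => hu (Sum.inl i) (by simpa using hi)
      have h2 : ∀ i ∈ P, inner ℝ (-a i) u ≤ 0 := fun i hi => hu (Sum.inr i) (by simpa using hi)
      refine h u ⟨h1, fun i hi => le_antisymm (h1 i (hPQ hi)) ?_⟩
      have := h2 i hi
      rw [inner_neg_left] at this
      linarith)
  rw [Finset.sum_disjSum] at hm
  simp only [Sum.elim_inl, Sum.elim_inr] at hm
  have hsplit : Q.toFinite.toFinset = (Q \ P).toFinite.toFinset ∪ P.toFinite.toFinset := by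
    ext i
    simp only [Set.Finite.mem_toFinset, Finset.mem_union, Set.mem_sdiff]
    exact ⟨fun hi => (em (i ∈ P)).elim Or.inr fun hp => Or.inl ⟨hi, hp⟩,
      fun hi => hi.elim And.left fun hp => hPQ hp⟩
  have hdisj : Disjoint (Q \ P).toFinite.toFinset P.toFinite.toFinset := by
    rw [Finset.disjoint_left]
    intro i hi
    simp only [Set.Finite.mem_toFinset, Set.mem_sdiff] at hi ⊢
    exact hi.2
  rw [hsplit, Finset.sum_union hdisj, add_assoc] at hm
  rw [hm]
  refine Set.add_mem_add ?_ (Submodule.add_mem _ ?_ ?_)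
  · refine Submodule.sum_mem _ fun i hi => ?_
    exact Submodule.smul_mem _ (⟨c (Sum.inl i), hc _⟩ : {c : ℝ // 0 ≤ c})
      (Submodule.subset_span ⟨i, by simpa using hi, rfl⟩)
  · exact Submodule.sum_mem _ fun i hi => Submodule.smul_mem _ _
      (Submodule.subset_span ⟨i, by simpa using hi, rfl⟩)
  · exact Submodule.sum_mem _ fun i hi => Submodule.smul_mem _ _
      (Submodule.neg_mem _ (Submodule.subset_span ⟨i, by simpa using hi, rfl⟩))

/-- An element of `A_{Q,P}` has nonpositive inner product with every `u` in its polar cone. -/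
theorem inner_nonpos_of_mem_setA {Q P : Set (Fin l)} {m u : E n} (hm : m ∈ setA a Q P)
    (hu : u ∈ setT a (Q \ P)) (hu' : ∀ i ∈ P, inner ℝ (a i) u = 0) : inner ℝ m u ≤ 0 := by
  obtain ⟨c, hc, s, hs, rfl⟩ := hm
  obtain ⟨μ, hμ, hμS, rfl⟩ := (mem_coneOf_iff a).1 hc
  have h1 : inner ℝ (∑ i, μ i • a i) u ≤ 0 := by
    rw [sum_inner]
    refine Finset.sum_nonpos fun i _ => ?_
    rw [real_inner_smul_left]
    by_cases hi : i ∈ Q \ P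
    · exact mul_nonpos_of_nonneg_of_nonpos (hμ i) (hu i hi)
    · rw [hμS i hi, zero_mul]
  have h2 : inner ℝ s u = 0 := by
    refine Submodule.span_induction (p := fun s _ => inner ℝ s u = 0) ?_ ?_ ?_ ?_ hs
    · rintro _ ⟨i, hi, rfl⟩
      exact hu' i hi
    · simp
    · intro x y _ _ hx hy
      rw [inner_add_left, hx, hy, add_zero]
    · intro r x _ hx
      rw [real_inner_smul_left, hx, mul_zero]
  simp only [inner_add_left]
  linarith

end Polyhedra

section Aubin

variable {n l : ℕ} {l₁ : ℕ} {a : Fin l → E n} {b : Fin l → ℝ} {xbar xstar : E n}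

theorem mem_polyhedron_univ {x : E n} (h₁ : x ∈ polyhedron a b (I₁ l l₁))
    (h₂ : x ∈ polyhedron a b (I₂ l l₁)) : x ∈ polyhedron a b Set.univ :=
  fun i _ => (lt_or_ge i.val l₁).elim (h₁ i) (h₂ i)

/-! ### The Aubin property and the tangent cone inclusion -/

/-- The Aubin property relative to `C` implies that the tangent cone to `C` lies in the
lineality space of the tangent cone to `Θ`. -/
theorem inner_eq_zero_of_hasAubinProperty (hxC : xbar ∈ polyhedron a b (I₂ l l₁))
    (hgph : (xbar, xstar) ∈ gph (normalConeMap (polyhedron a b (I₁ l l₁))))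
    (hA : HasAubinProperty (mapG (polyhedron a b (I₁ l l₁)) xstar)
      (polyhedron a b (I₂ l l₁)) xbar 0)
    {d : E n} (hd : d ∈ setT a (activeIn a b (I₂ l l₁) xbar)) {i : Fin l}
    (hi : i ∈ activeIn a b (I₁ l l₁) xbar) : inner ℝ (a i) d = 0 := by
  have hconv := convex_polyhedron a b (I₁ l l₁)
  obtain ⟨hxΘ, hstar⟩ := (mem_normalConeMap_iff hconv).1 hgph
  obtain ⟨-, -, κ, hκ, V, hV, U, hU, hlip⟩ := hA
  have hnormal : ∀ ε : ℝ, 0 ≤ ε → ε • a i ∈ mapG (polyhedron a b (I₁ l l₁)) xstar xbar := by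
    intro ε hε
    refine ⟨xstar + ε • a i, (mem_normalConeMap_iff hconv).2 ⟨hxΘ, fun z hz => ?_⟩, by abel⟩
    have h1 := hstar z hz
    have h2 : inner ℝ (a i) (z - xbar) ≤ 0 := by
      rw [inner_sub_right, hi.2]
      linarith [hz i hi.1]
    rw [inner_add_left, real_inner_smul_left]
    nlinarith
  obtain ⟨ε, hεV, hε0⟩ : ∃ ε : ℝ, ε • a i ∈ V ∧ 0 < ε := by
    have h := (tendsto_add_smul (0 : E n) (a i)).eventually hV
    simp only [zero_add] at h
    exact (h.and self_mem_nhdsWithin).exists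
  have hstep : ∀ᶠ s : ℝ in 𝓝[>] 0, inner ℝ (a i) d ≤ 0 ∧ inner ℝ xstar d ≤ 0 ∧
      -(κ * s * ‖d‖ * ‖d‖) ≤ inner ℝ (xstar + ε • a i) d := by
    filter_upwards [eventually_add_smul_mem_polyhedron a b hxC hd,
      (tendsto_add_smul xbar d).eventually hU, self_mem_nhdsWithin] with s hsC hsU hs0
    have hs0 : 0 < s := hs0
    -- Comparing the value `ε • a i` at `xbar` with the values at `xbar + s • d` makes the latter
    -- nonempty, which puts that point in `Θ`.
    obtain ⟨w', ⟨w, hw, rfl⟩, e, he, hsum⟩ := hlip (xbar + s • d) ⟨hsC, hsU⟩ xbar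
      ⟨hxC, mem_of_mem_nhds hU⟩ ⟨hnormal ε hε0.le, hεV⟩
    obtain ⟨hsΘ, hws⟩ := (mem_normalConeMap_iff hconv).1 hw
    obtain ⟨e', he', rfl⟩ := he
    have h1 : inner ℝ (a i) d ≤ 0 := by
      have := hsΘ i hi.1
      rw [inner_add_right, inner_smul_right, hi.2] at this
      exact nonpos_of_mul_nonpos_right (by linarith) hs0
    have h2 : inner ℝ xstar d ≤ 0 := by
      have := hstar _ hsΘ
      rw [add_sub_cancel_left, inner_smul_right] at this
      exact nonpos_of_mul_nonpos_right this hs0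
    have h3 : 0 ≤ inner ℝ w d := by
      have := hws xbar hxΘ
      rw [sub_add_cancel_left, inner_neg_right, inner_smul_right] at this
      exact nonneg_of_mul_nonneg_right (by linarith) hs0
    refine ⟨h1, h2, ?_⟩
    have hnorm : ‖xbar - (xbar + s • d)‖ = s * ‖d‖ := by
      rw [sub_add_cancel_left, norm_neg, norm_smul, Real.norm_of_nonneg hs0.le]
    simp only [hnorm] at hsum
    have hvec : xstar + ε • a i = w + (κ * (s * ‖d‖)) • e' := by
      rw [← hsum]; abel
    have hcs : -(‖d‖) ≤ inner ℝ e' d := by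
      have h4 := abs_real_inner_le_norm e' d
      have h5 : ‖e'‖ ≤ 1 := by simpa using he'
      have h6 : ‖e'‖ * ‖d‖ ≤ 1 * ‖d‖ := mul_le_mul_of_nonneg_right h5 (norm_nonneg _)
      linarith [neg_abs_le (inner ℝ e' d)]
    have h7 := mul_le_mul_of_nonneg_left hcs
      (mul_nonneg hκ (mul_nonneg hs0.le (norm_nonneg d)))
    rw [hvec, inner_add_left, real_inner_smul_left]
    linarith
  have hlimit : Tendsto (fun s : ℝ => -(κ * s * ‖d‖ * ‖d‖)) (𝓝[>] 0) (𝓝 0) := by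
    have : Continuous fun s : ℝ => -(κ * s * ‖d‖ * ‖d‖) := by fun_prop
    simpa using (this.tendsto 0).mono_left nhdsWithin_le_nhds
  have h0 : 0 ≤ inner ℝ (xstar + ε • a i) d := le_of_tendsto hlimit (hstep.mono fun s h => h.2.2)
  obtain ⟨s, h1, h2, -⟩ := hstep.exists
  rw [inner_add_left, real_inner_smul_left] at h0
  -- In the limit `⟨xstar, d⟩ + ε ⟨a i, d⟩ ≥ 0`, while `⟨xstar, d⟩ ≤ 0`.
  refine le_antisymm h1 ?_
  exact nonneg_of_mul_nonneg_right (by linarith) hε0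

/-- If the tangent cone to `C` lies in the lineality space of the tangent cone to `Θ`, then the
normal cone to `Θ` is locally constant on `C`. -/
theorem hasAubinProperty_of_inner_eq_zero
    (hgph : (xbar, xstar) ∈ gph (normalConeMap (polyhedron a b (I₁ l l₁))))
    (hT : ∀ d ∈ setT a (activeIn a b (I₂ l l₁) xbar), ∀ i ∈ activeIn a b (I₁ l l₁) xbar,
      inner ℝ (a i) d = 0) :
    HasAubinProperty (mapG (polyhedron a b (I₁ l l₁)) xstar)
      (polyhedron a b (I₂ l l₁)) xbar 0 := by
  have hconv := convex_polyhedron a b (I₁ l l₁)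
  have hxΘ := ((mem_normalConeMap_iff hconv).1 hgph).1
  refine ⟨⟨xstar, hgph, by simp⟩, ⟨Set.univ, univ_mem, isClosed_univ, ?_⟩, 0, le_rfl,
    Set.univ, univ_mem, _, eventually_inner_lt a b
      {i | i ∈ I₁ l l₁ ∧ inner ℝ (a i) xbar < b i} xbar fun i hi => hi.2, ?_⟩
  · rw [Set.inter_univ]
    exact isClosed_gph_mapG hconv (isClosed_polyhedron a b _) _
  have hactive : ∀ x ∈ polyhedron a b (I₂ l l₁), ∀ i ∈ activeIn a b (I₁ l l₁) xbar,
      inner ℝ (a i) x = b i := by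
    intro x hx i hi
    have := hT (x - xbar) (fun j hj => by
      rw [inner_sub_right, hj.2]
      linarith [hx j hj.1]) i hi
    rw [inner_sub_right, hi.2] at this
    linarith
  rintro x ⟨hxC', hxU⟩ u ⟨huC, huU⟩ g ⟨⟨w, hw, rfl⟩, -⟩
  have hxU : ∀ i ∈ {i | i ∈ I₁ l l₁ ∧ inner ℝ (a i) xbar < b i}, inner ℝ (a i) x < b i := hxU
  have huU : ∀ i ∈ {i | i ∈ I₁ l l₁ ∧ inner ℝ (a i) xbar < b i}, inner ℝ (a i) u < b i := huU
  obtain ⟨huΘ, hwu⟩ := (mem_normalConeMap_iff hconv).1 hw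
  have hxΘ' : x ∈ polyhedron a b (I₁ l l₁) := fun i hi =>
    (hxΘ i hi).lt_or_eq.elim (fun h => (hxU i ⟨hi, h⟩).le)
      fun h => (hactive x hxC' i ⟨hi, h⟩).le
  refine ⟨-xstar + w, ⟨w, (mem_normalConeMap_iff hconv).2 ⟨hxΘ', fun z hz => ?_⟩, rfl⟩, 0,
    ⟨0, by simp, by simp⟩, by simp⟩
  -- A constraint of `Θ` active at `u` is active at `xbar`, hence at `x`; so `z - x` is feasible at
  -- `u` and a normal at `u` can be tested against it.
  obtain ⟨s, hs, hs0⟩ := ((eventually_add_smul_mem_polyhedron a b (d := z - x) huΘ (by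
    intro i hi
    have hib : inner ℝ (a i) xbar = b i := (hxΘ i hi.1).lt_or_eq.resolve_left fun h =>
      (huU i ⟨hi.1, h⟩).ne hi.2
    rw [inner_sub_right, hactive x hxC' i ⟨hi.1, hib⟩]
    linarith [hz i hi.1])).and self_mem_nhdsWithin).exists
  have := hwu _ hs
  rw [add_sub_cancel_left, inner_smul_right] at this
  exact nonpos_of_mul_nonpos_right this hs0

/-! ### The face condition and the tangent cone inclusion -/

/-- The polyhedral condition for a single face follows from the inclusion of the tangent cone. -/
theorem eq_zero_of_mem_setA_inter_setT
    (hT : ∀ d ∈ setT a (activeIn a b (I₂ l l₁) xbar), ∀ i ∈ activeIn a b (I₁ l l₁) xbar,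
      inner ℝ (a i) d = 0)
    {Q P : Set (Fin l)} (hQ : Q ⊆ activeIn a b Set.univ xbar) (hne : (faceSet a b Q).Nonempty)
    {v : E n} (hvA : v ∈ setA a Q P) (hvT : v ∈ setT a (Q ∩ I₂ l l₁))
    (hP : P ⊆ Q ∩ I₁ l l₁) : v = 0 := by
  obtain ⟨x, hxQ, hxnQ⟩ := hne
  have hle : ∀ i, inner ℝ (a i) x ≤ b i := fun i =>
    (em (i ∈ Q)).elim (fun h => (hxQ i h).le) fun h => (hxnQ i h).le
  have hd : x - xbar ∈ setT a (activeIn a b (I₂ l l₁) xbar) := fun i hi => by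
    rw [inner_sub_right, hi.2]
    linarith [hle i]
  have hv : ∀ i ∈ activeIn a b (I₁ l l₁) xbar, inner ℝ (a i) v = 0 := by
    -- The tangent cone is the polyhedron with right-hand side `0`. At `x - xbar` only constraints
    -- in `Q` are active, so a small step along `v` stays in the cone.
    obtain ⟨s, hs, hs0⟩ := ((eventually_add_smul_mem_polyhedron a 0 (d := v) hd (by
      intro i hi
      refine hvT i ⟨by_contra fun hiQ => ?_, hi.1.1⟩
      have h1 := hi.2
      rw [inner_sub_right, hi.1.2, Pi.zero_apply] at h1
      linarith [hxnQ i hiQ])).and self_mem_nhdsWithin).exists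
    intro i hi
    have h1 := hT _ hs i hi
    rw [inner_add_right, hT _ hd i hi, inner_smul_right, zero_add] at h1
    exact (mul_eq_zero.1 h1).resolve_left (ne_of_gt hs0)
  -- `v` lies both in `A_{Q,P}` and in its polar, so `⟨v, v⟩ ≤ 0`.
  have := inner_nonpos_of_mem_setA a hvA (u := v)
    (fun i hi => (lt_or_ge i.val l₁).elim
      (fun h => (hv i ⟨h, (hQ hi.1).2⟩).le) fun h => hvT i ⟨hi.1, h⟩)
    (fun i hi => hv i ⟨(hP hi).2, (hQ (hP hi).1).2⟩)
  rw [real_inner_self_eq_norm_sq] at this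
  exact norm_eq_zero.1 (pow_eq_zero_iff two_ne_zero |>.1 (le_antisymm this (sq_nonneg _)))

/-- The polyhedral condition over the faces, used with `P = I₁(xbar)` on a largest face of `C`
orthogonal to all active gradients of `Θ`, yields the inclusion of the tangent cone. -/
theorem inner_eq_zero_of_face_condition (hxC : xbar ∈ polyhedron a b (I₂ l l₁))
    (hxΘ : xbar ∈ polyhedron a b (I₁ l l₁))
    (hcond : ∀ Q, activeIn a b (I₁ l l₁) xbar ⊆ Q → Q ⊆ activeIn a b Set.univ xbar →
      (faceSet a b Q).Nonempty →
      ∀ v ∈ setA a Q (activeIn a b (I₁ l l₁) xbar) ∩ setT a (Q ∩ I₂ l l₁), v = 0)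
    {v : E n} (hv : v ∈ setT a (activeIn a b (I₂ l l₁) xbar)) {i : Fin l}
    (hi : i ∈ activeIn a b (I₁ l l₁) xbar) : inner ℝ (a i) v = 0 := by
  set S₁ := activeIn a b (I₁ l l₁) xbar with hS₁
  set S₂ := activeIn a b (I₂ l l₁) xbar with hS₂
  set act : E n → Set (Fin l) :=
    fun d => {i | i ∈ activeIn a b Set.univ xbar ∧ inner ℝ (a i) d = 0} with hact
  obtain ⟨Q, ⟨d, hdT, hdL, rfl⟩, hmin⟩ := Set.Finite.exists_minimal
    (s := {Q | ∃ d ∈ setT a S₂, (∀ i ∈ S₁, inner ℝ (a i) d = 0) ∧ act d = Q})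
    (Set.toFinite _) ⟨_, 0, fun i _ => by simp, fun i _ => by simp, rfl⟩
  have hS₁Q : S₁ ⊆ act d := fun j hj => ⟨⟨trivial, hj.2⟩, hdL j hj⟩
  have hQ : act d ⊆ activeIn a b Set.univ xbar := fun j hj => hj.1
  have hsplit : ∀ j ∈ activeIn a b Set.univ xbar, j ∈ S₁ ∨ j ∈ S₂ := fun j hj =>
    (lt_or_ge j.val l₁).imp (fun h => ⟨h, hj.2⟩) fun h => ⟨h, hj.2⟩
  have hne : (faceSet a b (act d)).Nonempty := by
    refine faceSet_nonempty a b (mem_polyhedron_univ hxΘ hxC) hQ (fun j hj => hj.2)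
      fun j hj hjd => ?_
    rcases hsplit j hj with h | h
    · exact absurd (hS₁Q h) hjd
    · exact (hdT j h).lt_of_ne fun h0 => hjd ⟨hj, h0⟩
  -- Otherwise a small step from `d` along `w` would deactivate a constraint and keep the others
  -- inactive, contradicting minimality of `act d`.
  have hlin : ∀ w ∈ setT a (act d ∩ I₂ l l₁), (∀ j ∈ S₁, inner ℝ (a j) w = 0) →
      ∀ j ∈ act d, inner ℝ (a j) w = 0 := by
    intro w hw hwL
    obtain ⟨s, hs, hs0⟩ := ((eventually_add_smul_mem_polyhedron a 0 (d := w) hdT (by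
      intro j hj
      exact hw j ⟨⟨⟨trivial, hj.1.2⟩, hj.2⟩, hj.1.1⟩)).and
      ((tendsto_add_smul d w).eventually (eventually_inner_lt a 0
        {j | inner ℝ (a j) d < 0} d fun j hj => hj) |>.and self_mem_nhdsWithin)).exists
    have hsub : act (d + s • w) ⊆ act d := by
      intro j hj
      refine ⟨hj.1, ?_⟩
      rcases hsplit j hj.1 with h | h
      · exact hdL j h
      · by_contra hne0
        exact (hs0.1 j ((hdT j h).lt_of_ne hne0)).ne hj.2
    have hsup := hmin ⟨d + s • w, hs, fun j hj => by
      rw [inner_add_right, inner_smul_right, hdL j hj, hwL j hj, mul_zero, add_zero], rfl⟩ hsub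
    intro j hj
    have h1 := (hsup hj).2
    rw [inner_add_right, inner_smul_right, hj.2, zero_add] at h1
    exact (mul_eq_zero.1 h1).resolve_left (ne_of_gt hs0.2)
  -- The component `m` of `v` in the span of the gradients in `act d` has the same inner products
  -- with them as `v`; by `hlin` and bipolarity it belongs to `A`, so the face condition forces `m =
  -- 0`.
  obtain ⟨m, hm, w, hw, hvmw⟩ :=
    (Submodule.span ℝ (a '' act d)).exists_add_mem_mem_orthogonal v
  have hw0 : ∀ j ∈ act d, inner ℝ (a j) w = 0 := fun j hj =>
    hw _ (Submodule.subset_span ⟨j, hj, rfl⟩)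
  have hmA : m ∈ setA a (act d) S₁ := by
    refine mem_setA_of_inner_nonpos a hS₁Q fun u hu => ?_
    have hu0 := hlin u (fun j hj => hu.1 j hj.1) hu.2
    have hle : Submodule.span ℝ (a '' act d) ≤ (ℝ ∙ u)ᗮ := by
      rw [Submodule.span_le]
      rintro _ ⟨j, hj, rfl⟩
      rw [SetLike.mem_coe, Submodule.mem_orthogonal_singleton_iff_inner_left]
      exact hu0 j hj
    exact (Submodule.mem_orthogonal_singleton_iff_inner_left.1 (hle hm)).le
  have hmT : m ∈ setT a (act d ∩ I₂ l l₁) := fun j hj => by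
    have h1 := hv j ⟨hj.2, hj.1.1.2⟩
    rw [hvmw, inner_add_right, hw0 j hj.1, add_zero] at h1
    exact h1
  rw [hvmw, hcond _ hS₁Q hQ hne m ⟨hmA, hmT⟩, zero_add]
  exact hw0 i (hS₁Q hi)

/-! ### Linearly independent active gradients -/

/-- Under linear independence, the inner products with the `aᵢ` can be prescribed. -/
theorem exists_inner_eq {S : Set (Fin l)}
    (hli : LinearIndependent ℝ fun i : S => a i) (r : Fin l → ℝ) :
    ∃ d : E n, ∀ i ∈ S, inner ℝ (a i) d = r i := by
  obtain ⟨f, hf⟩ : ∃ f : E n →ₗ[ℝ] ℝ, ∀ i : S, f (a i) = r i := by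
    let B := Module.Basis.span hli
    obtain ⟨f, hf⟩ := LinearMap.exists_extend (B.constr ℝ fun i : S => r i)
    refine ⟨f, fun i => ?_⟩
    have h1 : f ((B i : E n)) = r i := by
      have := LinearMap.congr_fun hf (B i)
      simpa using this
    rwa [Module.Basis.span_apply] at h1
  refine ⟨(InnerProductSpace.toDual ℝ (E n)).symm (LinearMap.toContinuousLinearMap f),
    fun i hi => ?_⟩
  rw [real_inner_comm, InnerProductSpace.toDual_symm_apply]
  exact hf ⟨i, hi⟩

/-- Under linear independence, `P` generates `xbar*` exactly if it contains the support of the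
multipliers. -/
theorem mem_familyP_iff (hli : LinearIndependent ℝ fun i : activeIn a b Set.univ xbar => a i)
    {lam : Fin l → ℝ} (hlam : IsMultiplier l₁ a b xbar xstar lam) {P : Set (Fin l)}
    (hP : P ⊆ activeIn a b (I₁ l l₁) xbar) :
    P ∈ familyP l₁ a b xbar xstar ↔ positiveSupport lam ⊆ P := by
  obtain ⟨hnn, hout, hsum⟩ := hlam
  constructor
  · rintro ⟨-, hcone⟩ i hi
    obtain ⟨c, hc, hcP, hcsum⟩ := (mem_coneOf_iff a).1 hcone
    by_contra hiP
    have hi1 : i ∈ activeIn a b (I₁ l l₁) xbar := by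
      by_contra h
      exact (ne_of_gt hi) (hout i h)
    classical
    -- A dual vector that reads off the `i`-th coefficient of any representation over the active
    -- gradients.
    obtain ⟨d, hd⟩ := exists_inner_eq hli (Pi.single i 1)
    have h1 : ∀ μ : Fin l → ℝ, (∀ j ∉ activeIn a b (I₁ l l₁) xbar, μ j = 0) →
        inner ℝ (∑ j, μ j • a j) d = μ i := by
      intro μ hμ
      rw [sum_inner, Finset.sum_eq_single i]
      · rw [real_inner_smul_left, hd i ⟨trivial, hi1.2⟩, Pi.single_eq_same, mul_one]
      · intro j _ hji
        rw [real_inner_smul_left]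
        by_cases hj : j ∈ activeIn a b (I₁ l l₁) xbar
        · rw [hd j ⟨trivial, hj.2⟩, Pi.single_eq_of_ne hji, mul_zero]
        · rw [hμ j hj, zero_mul]
      · simp
    have h2 := h1 lam hout
    rw [← hsum, hcsum, h1 c fun j hj => hcP j fun h => hj (hP h), hcP i hiP] at h2
    exact (ne_of_gt hi) h2.symm
  · intro h
    refine ⟨hP, (mem_coneOf_iff a).2 ⟨lam, hnn, fun i hi => ?_, hsum⟩⟩
    exact ((hnn i).lt_or_eq.resolve_left fun h0 => hi (h h0)).symm

end Aubin

end RelAubin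

open RelAubin in
theorem mainTheorem7 {n l : ℕ} (l₁ : ℕ) (hl : l₁ ≤ l)
    (a : Fin l → E n) (b : Fin l → ℝ) (Θ C : Set (E n))
    (hΘ : Θ = polyhedron a b (I₁ l l₁)) (hC : C = polyhedron a b (I₂ l l₁))
    (xbar xstar : E n) (hxC : xbar ∈ C)
    (hgph : (xbar, xstar) ∈ gph (normalConeMap Θ)) :
    (HasAubinProperty (mapG Θ xstar) C xbar 0 ↔
      ∀ Q P : Set (Fin l), Q ⊆ activeIn a b Set.univ xbar →
        P ∈ familyP l₁ a b xbar xstar → (faceSet a b Q).Nonempty → P ⊆ Q ∩ I₁ l l₁ →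
        ∀ v : E n, (v, (0 : E n)) ∈
          (setA a Q P ∩ setT a (Q ∩ I₂ l l₁)) ×ˢ setB a (Q ∩ I₁ l l₁) P → v = 0) ∧
    (LinearIndependent ℝ (fun i : activeIn a b Set.univ xbar => a i) →
      ∀ lam : Fin l → ℝ, IsMultiplier l₁ a b xbar xstar lam →
        (HasAubinProperty (mapG Θ xstar) C xbar 0 ↔
          ∀ Q P : Set (Fin l), Q ⊆ activeIn a b Set.univ xbar →
            positiveSupport lam ⊆ P → P ⊆ Q ∩ I₁ l l₁ →
            ∀ v : E n, (v, (0 : E n)) ∈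
              (setA a Q P ∩ setT a (Q ∩ I₂ l l₁)) ×ˢ setB a (Q ∩ I₁ l l₁) P → v = 0)) := by
  subst hΘ hC
  have hnorm := (mem_normalConeMap_iff (convex_polyhedron a b (I₁ l l₁))).1 hgph
  have hxΘ := hnorm.1
  have hmain : HasAubinProperty (mapG (polyhedron a b (I₁ l l₁)) xstar)
      (polyhedron a b (I₂ l l₁)) xbar 0 ↔
      ∀ Q P : Set (Fin l), Q ⊆ activeIn a b Set.univ xbar →
        P ∈ familyP l₁ a b xbar xstar → (faceSet a b Q).Nonempty → P ⊆ Q ∩ I₁ l l₁ →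
        ∀ v : E n, (v, (0 : E n)) ∈
          (setA a Q P ∩ setT a (Q ∩ I₂ l l₁)) ×ˢ setB a (Q ∩ I₁ l l₁) P → v = 0 := by
    constructor
    · intro hA Q P hQ _ hne hPQ v hv
      exact eq_zero_of_mem_setA_inter_setT
        (fun d hd i hi => inner_eq_zero_of_hasAubinProperty hxC hgph hA hd hi)
        hQ hne hv.1.1 hv.1.2 hPQ
    · intro hcond
      refine hasAubinProperty_of_inner_eq_zero hgph fun d hd i hi =>
        inner_eq_zero_of_face_condition hxC hxΘ (fun Q hS hQ hne v hv => ?_) hd hi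
      -- `P = I₁(xbar)` always generates `xstar`, and `0 ∈ B_{Q,P}` is automatic.
      exact hcond Q _ hQ ⟨subset_rfl, mem_coneOf_activeIn_of_normal a b hxΘ hnorm.2⟩ hne
        (fun j hj => ⟨hS hj, hj.1⟩) v ⟨hv, fun _ _ => by simp, fun _ _ => by simp⟩
  refine ⟨hmain, fun hli lam hlam => hmain.trans (forall₃_congr fun Q P hQ => ?_)⟩
  have hface : (faceSet a b Q).Nonempty := by
    classical
    -- A direction that keeps the constraints in `Q` active and strictly relaxes every other active
    -- one.
    obtain ⟨d, hd⟩ := exists_inner_eq hli fun i => if i ∈ Q then 0 else -1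
    refine faceSet_nonempty a b (d := d) (mem_polyhedron_univ hxΘ hxC) hQ (fun i hi => ?_)
      fun i hi hiQ => ?_
    · rw [hd i (hQ hi), if_pos hi]
    · rw [hd i hi, if_neg hiQ]
      norm_num
  have hP : P ⊆ Q ∩ I₁ l l₁ → P ⊆ activeIn a b (I₁ l l₁) xbar := fun h i hi =>
    ⟨(h hi).2, (hQ (h hi).1).2⟩
  exact ⟨fun h hsupp hPQ => h ((mem_familyP_iff hli hlam (hP hPQ)).2 hsupp) hface hPQ,
    fun h hfam _ hPQ => h ((mem_familyP_iff hli hlam (hP hPQ)).1 hfam) hPQ⟩
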